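/- **Model.** A symbolic algorithm for directed graphs $G=(V,E)$ with a known vertex set $V$ can access $E$ only through the one-step operations $\mathrm{Pre}(S)=\{v\in V\mid \exists s\in S:(v,s)\in E\}$ and $\mathrm{Post}(S)=\{v\in V\mid \exists s\in S:(s,v)\in E\}$ with $S\subseteq V$. Between one-step operations it may do any other computation, including set operations, and store any number of sets; only one-step operations are counted. A randomized symbolic algorithm is a probability distribution over deterministic ones; it computes the SCCs with error at most $\varepsilon$ if on every graph with vertex set $V$ it outputs exactly the set of strongly connected components with probability at least $1-\varepsilon$. Let $SCCs(G)$ be the set of strongly connected components of $G$ (including trivial ones), and for $C\in SCCs(G)$ let $D_C$ be the diameter of (the subgraph induced by) $C$. **Theorem.** Any deterministic or bounded-error randomized symbolic algorithm that computes the SCCs needs $\Omega\bigl(|SCCs(G)|+\sum_{C\in SCCs(G)}D_C\bigr)$ one-step operations, in the following sense, for every pair of values of the two parameters. 1. There is a constant $c>0$ such that for all integers $s\ge 1$ and $d\ge 0$ with $n=s+d\ge 2$, and every deterministic symbolic algorithm that computes the SCCs of all directed graphs with vertex set $V=\{0,\dots,n-1\}$, there is a directed graph $G$ on $V$ with $|SCCs(G)|=s$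 and $\sum_{C\in SCCs(G)}D_C=d$ on which the algorithm performs at least $c\,(s+d)$ one-step operations. 2. For every $\varepsilon\in[0,1/2)$ there is a constant $c>0$ such that for all integers $s\ge 1$ and $d\ge 0$ with $n=s+d\ge 2$, and every randomized symbolic algorithm that computes the SCCs of all directed graphs with vertex set $V=\{0,\dots,n-1\}$ with error at most $\varepsilon$, there is a directed graph $G$ on $V$ with $|SCCs(G)|=s$ and $\sum_{C\in SCCs(G)}D_C=d$ on which the expected number of one-step operations (hence also the worst-case number over the coin tosses) is at least $c\,(s+d)$. -/

import Mathlib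

open scoped ENNReal

namespace SymbolicSCC

/-! ### Directed graphs: distances, strongly connected components, diameters -/

section Graphs

variable {V : Type*}

/-- `HasWalk G m u v`: there is a walk from `u` to `v` in `G` with exactly `m` edges. -/
def HasWalk (G : Digraph V) : ℕ → V → V → Prop
  | 0, u, v => u = v
  | m + 1, u, v => ∃ w, G.Adj u w ∧ HasWalk G m w v

/-- `u` can reach `v` in `G` (by a walk of some length, possibly `0`). -/
def Reachable (G : Digraph V) (u v : V) : Prop := ∃ m, HasWalk G m u v

/-- The smallest number of edges of a walk from `u` to `v`.
It is only used for `u`, `v` such that `u` can reach `v`. -/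
noncomputable def dist (G : Digraph V) (u v : V) : ℕ := sInf {m | HasWalk G m u v}

/-- The diameter of `G`: the maximum of `dist G u v` over all pairs `u`, `v` for which `u` can
reach `v`. It is only used for finite `V`, where the supremum is over a finite set. -/
noncomputable def diam (G : Digraph V) : ℕ :=
  sSup {m | ∃ u v, Reachable G u v ∧ dist G u v = m}

/-- The subgraph of `G` induced by the vertex set `C`. -/
def induce (G : Digraph V) (C : Set V) : Digraph C where
  Adj u v := G.Adj u v

/-- The strongly connected component of the vertex `v`. -/
def sccOf (G : Digraph V) (v : V) : Set V := {w | Reachable G v w ∧ Reachable G w v}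

/-- The set of all strongly connected components of `G`; trivial ones (with a single vertex)
are included. -/
def SCCs (G : Digraph V) : Set (Set V) := Set.range (sccOf G)

/-- The sum of the diameters of the strongly connected components of `G` (for finite `V`). -/
noncomputable def sumSCCDiam (G : Digraph V) : ℕ := ∑ᶠ C ∈ SCCs G, diam (induce G C)

/-- The set of predecessors of the vertices of `S`. -/
def Pre (G : Digraph V) (S : Set V) : Set V := {v | ∃ s ∈ S, G.Adj v s}

/-- The set of successors of the vertices of `S`. -/
def Post (G : Digraph V) (S : Set V) : Set V := {v | ∃ s ∈ S, G.Adj s v}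

end Graphs

/-! ### Symbolic algorithms -/

/-- The two kinds of symbolic one-step operations. -/
inductive OneStepOp
  | pre
  | post

/-- The result of a one-step operation applied to the vertex set `S` of the graph `G`. -/
def OneStepOp.apply {V : Type*} (op : OneStepOp) (G : Digraph V) (S : Set V) : Set V :=
  match op with
  | .pre => Pre G S
  | .post => Post G S

/-- A deterministic symbolic algorithm that is run on graphs with the (known) vertex set `V` and
outputs a family of vertex sets.

The algorithm has no access to the edges other than through the one-step operations. Between two
one-step operations it may perform any number of basic set operations and of non-symbolic
operations and may store any number of sets, all free of charge; so the next operation and the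
set `S` to which it is applied may depend in any way on the results of all earlier one-step
operations. Hence an algorithm is a decision tree: it either stops with an output, or applies a
one-step operation to a set `S` and continues according to the resulting set. -/
inductive SymbolicAlgorithm (V : Type*)
  | output (R : Set (Set V))
  | oneStep (op : OneStepOp) (S : Set V) (next : Set V → SymbolicAlgorithm V)

namespace SymbolicAlgorithm

variable {V : Type*}

/-- The output of the algorithm on the input graph `G`. -/
def run (G : Digraph V) : SymbolicAlgorithm V → Set (Set V)
  | output R => R
  | oneStep op S next => run G (next (op.apply G S))

/-- The number of one-step operations that the algorithm performs on the input graph `G`. -/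
def cost (G : Digraph V) : SymbolicAlgorithm V → ℕ
  | output _ => 0
  | oneStep op S next => cost G (next (op.apply G S)) + 1

/-- The algorithm computes the strongly connected components of every graph on `V`. -/
def ComputesSCCs (A : SymbolicAlgorithm V) : Prop := ∀ G : Digraph V, A.run G = SCCs G

end SymbolicAlgorithm

/-- A randomized symbolic algorithm on the vertex set `V`: a probability distribution on
deterministic symbolic algorithms, i.e. the algorithm that results once all coins are tossed.
(For finite `V` there are only countably many deterministic algorithms.) -/
abbrev RandomizedSymbolicAlgorithm (V : Type*) := PMF (SymbolicAlgorithm V)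

namespace RandomizedSymbolicAlgorithm

variable {V : Type*}

/-- The probability that the algorithm outputs exactly the strongly connected components of the
input graph `G`. -/
noncomputable def successProb (A : RandomizedSymbolicAlgorithm V) (G : Digraph V) : ℝ≥0∞ :=
  A.toOuterMeasure {a | a.run G = SCCs G}

/-- The expected number of one-step operations that the algorithm performs on `G`. -/
noncomputable def expectedCost (A : RandomizedSymbolicAlgorithm V) (G : Digraph V) : ℝ≥0∞ :=
  ∑' a, A a * (a.cost G : ℝ≥0∞)

/-- The algorithm computes the strongly connected components of every graph on `V` with error
probability at most `ε`. -/
def ComputesSCCsWithError (A : RandomizedSymbolicAlgorithm V) (ε : ℝ) : Prop :=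
  ∀ G : Digraph V, ENNReal.ofReal (1 - ε) ≤ successProb A G

end RandomizedSymbolicAlgorithm

end SymbolicSCC

namespace SymbolicSCC

/-! ### Walks, reachability and components -/

section Graphs

variable {V : Type*} {G : Digraph V}

/-! The hard instances contain every backward edge plus optional forward edges `i → i + 1`, `i ∈ E`.
Toggling one optional edge with `i + 1 < n` changes the components (`SCCs_stepGraph_ne`), so the
output determines all `n - 1` of them. The backward edges swamp a one-step operation: its result
depends on at most two optional edges near the minimum or maximum of the queried set
(`exists_card_le_two_apply_eq`). A correct run therefore costs at least `(n - 1) / 2`, whatever `E`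
is. In the randomized case, each optional edge is inspected with probability at least `1 - 2ε`, and
summing over the edges bounds the expected cost.

Since the bound holds for every `E`, the parameters can be prescribed: `E = {0, …, d - 1}` gives one
component `{0, …, d}` of diameter `d` and `s - 1` singletons. -/

theorem HasWalk.append {k l : ℕ} {u v w : V} (h₁ : HasWalk G k u v) (h₂ : HasWalk G l v w) :
    HasWalk G (k + l) u w := by
  induction k generalizing u with
  | zero => obtain rfl : u = v := h₁; simpa using h₂
  | succ k ih =>
    obtain ⟨x, hx, h⟩ := h₁
    rw [Nat.add_right_comm]
    exact ⟨x, hx, ih h⟩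

theorem Reachable.refl (u : V) : Reachable G u u := ⟨0, rfl⟩

theorem Reachable.trans {u v w : V} (h₁ : Reachable G u v) (h₂ : Reachable G v w) :
    Reachable G u w := by
  obtain ⟨k, hk⟩ := h₁
  obtain ⟨l, hl⟩ := h₂
  exact ⟨k + l, hk.append hl⟩

theorem Reachable.of_adj {u v : V} (h : G.Adj u v) : Reachable G u v := ⟨1, v, h, rfl⟩

theorem mem_sccOf_self (v : V) : v ∈ sccOf G v := ⟨.refl v, .refl v⟩

/-- Two vertices in a common component of `G` reach each other in every graph with the same
components. -/
theorem reachable_of_SCCs_eq {G' : Digraph V} (h : SCCs G = SCCs G') {u v : V}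
    (hv : v ∈ sccOf G u) : Reachable G' u v := by
  have hmem : sccOf G u ∈ SCCs G' := h ▸ ⟨u, rfl⟩
  obtain ⟨w, hw⟩ := hmem
  have h₁ : u ∈ sccOf G' w := hw ▸ mem_sccOf_self u
  have h₂ : v ∈ sccOf G' w := hw ▸ hv
  exact h₁.2.trans h₂.1

theorem dist_self (u : V) : dist G u u = 0 :=
  Nat.sInf_eq_zero.2 (.inl rfl)

theorem HasWalk.dist_le {m : ℕ} {u v : V} (h : HasWalk G m u v) : dist G u v ≤ m :=
  Nat.sInf_le h

theorem diam_eq_zero_of_subsingleton [Subsingleton V] : diam G = 0 := by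
  refine Nat.le_zero.1 (csSup_le' ?_)
  rintro _ ⟨u, v, -, rfl⟩
  rw [Subsingleton.elim v u, dist_self]

end Graphs

/-! ### A family of graphs whose components are intervals -/

/-- The graph on `Fin n` with all edges from larger to smaller vertices, and with the edges
`i → i + 1` for `i ∈ E`. -/
def stepGraph (n : ℕ) (E : Set ℕ) : Digraph (Fin n) where
  Adj u v := v.val < u.val ∨ (v.val = u.val + 1 ∧ u.val ∈ E)

theorem stepGraph_adj {n : ℕ} {E : Set ℕ} {u v : Fin n} :
    (stepGraph n E).Adj u v ↔ v.val < u.val ∨ (v.val = u.val + 1 ∧ u.val ∈ E) := Iff.rfl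

/-- Without the edge `i → i + 1`, the vertices up to `i` cannot be left. -/
theorem le_of_reachable_stepGraph {n : ℕ} {E : Set ℕ} {i : ℕ} (hi : i ∉ E) {u v : Fin n}
    (h : Reachable (stepGraph n E) u v) (hu : u.val ≤ i) : v.val ≤ i := by
  obtain ⟨m, hm⟩ := h
  induction m generalizing u with
  | zero => obtain rfl : u = v := hm; exact hu
  | succ m ih =>
    obtain ⟨w, hw, h⟩ := hm
    refine ih ?_ h
    rcases hw with hw | ⟨hw, huE⟩
    · omega
    · have : u.val ≠ i := fun h => hi (h ▸ huE)
      omega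

/-- With the edge, `i` and `i + 1` form a cycle; without it, no walk leads from `i` up to `i + 1`.
-/
theorem SCCs_stepGraph_ne_of_mem {n : ℕ} {E E' : Set ℕ} {i : ℕ} (hin : i + 1 < n)
    (hE : i ∈ E) (hE' : i ∉ E') : SCCs (stepGraph n E) ≠ SCCs (stepGraph n E') := by
  intro h
  have hmem : (⟨i + 1, hin⟩ : Fin n) ∈ sccOf (stepGraph n E) ⟨i, by omega⟩ :=
    ⟨.of_adj (.inr ⟨rfl, hE⟩), .of_adj (.inl (Nat.lt_succ_self i))⟩
  have := le_of_reachable_stepGraph hE' (reachable_of_SCCs_eq h hmem) le_rfl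
  simp at this

theorem SCCs_stepGraph_ne {n : ℕ} {E E' : Set ℕ} {i : ℕ} (hin : i + 1 < n)
    (h : ¬(i ∈ E ↔ i ∈ E')) : SCCs (stepGraph n E) ≠ SCCs (stepGraph n E') := by
  by_cases hE : i ∈ E
  · exact SCCs_stepGraph_ne_of_mem hin hE (by tauto)
  · exact (SCCs_stepGraph_ne_of_mem hin (by tauto) hE).symm

/-! ### The member of the family with one long component -/

theorem reachable_stepGraph_Iio {n d : ℕ} {u v : Fin n} :
    Reachable (stepGraph n (Set.Iio d)) u v ↔ v.val ≤ u.val ∨ v.val ≤ d := by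
  constructor
  · intro h
    by_cases hu : u.val ≤ d
    · exact .inr (le_of_reachable_stepGraph (by simp) h hu)
    · exact .inl (le_of_reachable_stepGraph (by simp; omega) h le_rfl)
  · intro h
    rcases lt_trichotomy v.val u.val with hvu | hvu | hvu
    · exact .of_adj (.inl hvu)
    · rw [Fin.ext hvu]; exact .refl u
    · obtain ⟨m, hm⟩ := Nat.exists_eq_add_of_lt hvu
      induction m generalizing u with
      | zero => exact .of_adj (.inr ⟨hm, by simp; omega⟩)
      | succ m ih =>
        have hadj : (stepGraph n (Set.Iio d)).Adj u ⟨u.val + 1, by omega⟩ :=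
          .inr ⟨rfl, by simp; omega⟩
        exact (Reachable.of_adj hadj).trans (ih (by omega) (by simp; omega) (by simp; omega))

theorem mem_sccOf_stepGraph_Iio {n d : ℕ} {u v : Fin n} :
    v ∈ sccOf (stepGraph n (Set.Iio d)) u ↔ v = u ∨ (u.val ≤ d ∧ v.val ≤ d) := by
  simp only [sccOf, Set.mem_ofPred_eq, reachable_stepGraph_Iio, Fin.ext_iff]
  omega

theorem ncard_SCCs_stepGraph_Iio {s d : ℕ} (hs : 1 ≤ s) :
    (SCCs (stepGraph (s + d) (Set.Iio d))).ncard = s := by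
  -- The vertices `d, …, s + d - 1` represent the components: `d` the long one, the others the
  -- singletons.
  let f : Fin s → Set (Fin (s + d)) :=
    fun k => sccOf (stepGraph (s + d) (Set.Iio d)) ⟨d + k, by omega⟩
  have hf : Function.Injective f := by
    intro k l hkl
    have hmem : (⟨d + k, by omega⟩ : Fin (s + d)) ∈ f l := hkl ▸ mem_sccOf_self _
    rw [mem_sccOf_stepGraph_Iio] at hmem
    simp only [Fin.mk.injEq] at hmem
    exact Fin.ext (by omega)
  have hrange : SCCs (stepGraph (s + d) (Set.Iio d)) = Set.range f := by
    refine subset_antisymm ?_ ?_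
    · rintro _ ⟨v, rfl⟩
      -- Truncated subtraction sends every vertex of the long component to index `0`.
      refine ⟨⟨v.val - d, by omega⟩, ?_⟩
      ext w
      simp only [f, mem_sccOf_stepGraph_Iio, Fin.ext_iff]
      omega
    · rintro _ ⟨k, rfl⟩
      exact ⟨_, rfl⟩
  rw [hrange, ← Nat.card_coe_set_eq, Nat.card_range_of_injective hf, Nat.card_eq_fintype_card,
    Fintype.card_fin]

/-- An edge raises the index by at most one. This makes `0` and `d` lie at distance at least `d`. -/
theorem le_add_of_hasWalk_induce_stepGraph {n : ℕ} {E : Set ℕ} {C : Set (Fin n)} {m : ℕ}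
    {u v : C} (h : HasWalk (induce (stepGraph n E) C) m u v) : v.1.val ≤ u.1.val + m := by
  induction m generalizing u with
  | zero => obtain rfl : u = v := h; omega
  | succ m ih =>
    obtain ⟨w, hw, h⟩ := h
    have := ih h
    rcases hw with hw | ⟨hw, -⟩ <;> omega

theorem hasWalk_induce_stepGraph_Iio {n d : ℕ} {C : Set (Fin n)} (hC : ∀ v, v ∈ C ↔ v.val ≤ d)
    {m : ℕ} {u v : C} (h : v.1.val = u.1.val + m) :
    HasWalk (induce (stepGraph n (Set.Iio d)) C) m u v := by
  induction m generalizing u with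
  | zero => exact Subtype.ext (Fin.ext h.symm)
  | succ m ih =>
    have hv := (hC v).1 v.2
    exact ⟨⟨⟨u.1.val + 1, by omega⟩, (hC _).2 (by simp; omega)⟩,
      .inr ⟨rfl, by simp; omega⟩, ih (by simp; omega)⟩

theorem diam_induce_stepGraph_Iio {n d : ℕ} (hd : d < n) {C : Set (Fin n)}
    (hC : ∀ v, v ∈ C ↔ v.val ≤ d) : diam (induce (stepGraph n (Set.Iio d)) C) = d := by
  have hle : ∀ m ∈ {m | ∃ u v, Reachable (induce (stepGraph n (Set.Iio d)) C) u v ∧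
      dist (induce (stepGraph n (Set.Iio d)) C) u v = m}, m ≤ d := by
    rintro _ ⟨u, v, -, rfl⟩
    have hu := (hC u).1 u.2
    have hv := (hC v).1 v.2
    by_cases huv : u.1.val ≤ v.1.val
    · refine (hasWalk_induce_stepGraph_Iio hC (m := v.1.val - u.1.val) ?_).dist_le.trans ?_ <;>
        omega
    -- Here `v < u ≤ d` forces `d ≥ 1`, so a single backward edge stays within the bound.
    · have hwalk : HasWalk (induce (stepGraph n (Set.Iio d)) C) 1 u v :=
        ⟨v, .inl (not_le.1 huv), rfl⟩
      exact hwalk.dist_le.trans (by omega)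
  refine le_antisymm (csSup_le' hle) (le_csSup ⟨d, hle⟩ ?_)
  let a : C := ⟨⟨0, by omega⟩, (hC _).2 (by simp)⟩
  let b : C := ⟨⟨d, hd⟩, (hC _).2 le_rfl⟩
  have hwalk : HasWalk (induce (stepGraph n (Set.Iio d)) C) d a b :=
    hasWalk_induce_stepGraph_Iio hC (by simp [a, b])
  refine ⟨a, b, ⟨d, hwalk⟩, le_antisymm hwalk.dist_le ?_⟩
  refine le_csInf ⟨d, hwalk⟩ fun m hm => ?_
  simpa [a, b] using le_add_of_hasWalk_induce_stepGraph hm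

theorem sumSCCDiam_stepGraph_Iio {n d : ℕ} (hd : d < n) :
    sumSCCDiam (stepGraph n (Set.Iio d)) = d := by
  have hC : ∀ v, v ∈ sccOf (stepGraph n (Set.Iio d)) ⟨d, hd⟩ ↔ v.val ≤ d := fun v => by
    simp only [mem_sccOf_stepGraph_Iio, Fin.ext_iff]
    omega
  classical
  rw [sumSCCDiam, finsum_eq_single _ (sccOf (stepGraph n (Set.Iio d)) ⟨d, hd⟩),
    finsum_eq_if, if_pos ⟨_, rfl⟩, diam_induce_stepGraph_Iio hd hC]
  intro C hne
  rw [finsum_eq_if]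
  split_ifs with hmem
  swap
  · rfl
  obtain ⟨v, rfl⟩ := hmem
  have hv : d < v.val := by
    by_contra! hv
    refine hne (Set.ext fun w => ?_)
    simp only [mem_sccOf_stepGraph_Iio, Fin.ext_iff]
    omega
  have : Subsingleton (sccOf (stepGraph n (Set.Iio d)) v) := by
    rw [Set.subsingleton_coe]
    intro x hx y hy
    rw [mem_sccOf_stepGraph_Iio] at hx hy
    simp only [Fin.ext_iff] at hx hy ⊢
    omega
  exact diam_eq_zero_of_subsingleton

/-! ### The information gained by one-step operations -/

/-- The result of a one-step operation depends on at most two of the optional edges. -/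
theorem exists_card_le_two_apply_eq {n : ℕ} (op : OneStepOp) (S : Set (Fin n)) :
    ∃ Q : Finset ℕ, Q.card ≤ 2 ∧ ∀ E E' : Set ℕ, (∀ i ∈ Q, i ∈ E ↔ i ∈ E') →
      op.apply (stepGraph n E) S = op.apply (stepGraph n E') S := by
  rcases S.eq_empty_or_nonempty with rfl | hS
  · exact ⟨∅, by simp, fun E E' _ => by cases op <;> simp [OneStepOp.apply, Pre, Post]⟩
  cases op with
  | pre =>
    obtain ⟨m, hmS, hm⟩ := S.toFinite.exists_minimal hS
    replace hm : ∀ x ∈ S, m ≤ x := fun x hx => (le_total m x).elim id (hm hx)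
    -- Every `v > m` is a predecessor of the minimum `m` in any case. If `v ≤ m`, a forward edge
    -- into `S` has `v + 1 ≥ m`, which leaves only `v = m - 1` and `v = m`.
    refine ⟨{m.val - 1, m.val}, Finset.card_le_two, fun E E' hE => Set.ext fun v => ?_⟩
    have key : ∀ E E' : Set ℕ, (∀ i ∈ ({m.val - 1, m.val} : Finset ℕ), i ∈ E ↔ i ∈ E') →
        v ∈ Pre (stepGraph n E) S → v ∈ Pre (stepGraph n E') S := by
      rintro E E' hE ⟨x, hx, hxv | ⟨hxv, hvE⟩⟩
      · exact ⟨x, hx, .inl hxv⟩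
      · by_cases hmv : m < v
        · exact ⟨m, hmS, .inl hmv⟩
        · have := Fin.le_def.1 (hm x hx)
          have := Fin.le_def.1 (not_lt.1 hmv)
          exact ⟨x, hx, .inr ⟨hxv, (hE v (by simp; omega)).1 hvE⟩⟩
    exact ⟨key E E' hE, key E' E fun i hi => (hE i hi).symm⟩
  | post =>
    obtain ⟨m, hmS, hm⟩ := S.toFinite.exists_maximal hS
    replace hm : ∀ x ∈ S, x ≤ m := fun x hx => (le_total x m).elim id (hm hx)
    -- Dually, every `v < m` is a successor of the maximum `m`. If `v ≥ m`, a forward edge `x → v`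
    -- from `S` has `m - 1 ≤ x ≤ m`.
    refine ⟨{m.val - 1, m.val}, Finset.card_le_two, fun E E' hE => Set.ext fun v => ?_⟩
    have key : ∀ E E' : Set ℕ, (∀ i ∈ ({m.val - 1, m.val} : Finset ℕ), i ∈ E ↔ i ∈ E') →
        v ∈ Post (stepGraph n E) S → v ∈ Post (stepGraph n E') S := by
      rintro E E' hE ⟨x, hx, hxv | ⟨hxv, hxE⟩⟩
      · exact ⟨x, hx, .inl hxv⟩
      · by_cases hmv : v < m
        · exact ⟨m, hmS, .inl hmv⟩
        · have := Fin.le_def.1 (hm x hx)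
          have := Fin.le_def.1 (not_lt.1 hmv)
          exact ⟨x, hx, .inr ⟨hxv, (hE x (by simp; omega)).1 hxE⟩⟩
    exact ⟨key E E' hE, key E' E fun i hi => (hE i hi).symm⟩

/-- The output of an algorithm depends on at most two optional edges per one-step operation. -/
theorem SymbolicAlgorithm.exists_card_le_run_eq {n : ℕ} (A : SymbolicAlgorithm (Fin n))
    (E : Set ℕ) :
    ∃ Q : Finset ℕ, Q.card ≤ 2 * A.cost (stepGraph n E) ∧
      ∀ E' : Set ℕ, (∀ i ∈ Q, i ∈ E ↔ i ∈ E') →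
        A.run (stepGraph n E) = A.run (stepGraph n E') := by
  induction A with
  | output R => exact ⟨∅, by simp, fun _ _ => rfl⟩
  | oneStep op S next ih =>
    obtain ⟨Q₁, hcard₁, h₁⟩ := exists_card_le_two_apply_eq op S
    -- Only the branch taken on `E` matters: agreement on `Q₁` keeps `E'` on the same branch.
    obtain ⟨Q₂, hcard₂, h₂⟩ := ih (op.apply (stepGraph n E) S)
    refine ⟨Q₁ ∪ Q₂, ?_, fun E' hE' => ?_⟩
    · have := Finset.card_union_le Q₁ Q₂
      rw [cost]
      omega
    · rw [run, run, h₂ E' fun i hi => hE' i (Finset.mem_union_right _ hi),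
        h₁ E E' fun i hi => hE' i (Finset.mem_union_left _ hi)]

/-- An algorithm that is correct both with and without the optional edge `i → i + 1` has to
inspect this edge. -/
theorem mem_of_run_eq_SCCs {n : ℕ} {A : SymbolicAlgorithm (Fin n)} {E : Set ℕ} {Q : Finset ℕ}
    (hQ : ∀ E' : Set ℕ, (∀ i ∈ Q, i ∈ E ↔ i ∈ E') →
      A.run (stepGraph n E) = A.run (stepGraph n E'))
    {i : ℕ} (hi : i + 1 < n) (h₁ : A.run (stepGraph n E) = SCCs (stepGraph n E))
    (h₂ : A.run (stepGraph n (symmDiff E {i})) = SCCs (stepGraph n (symmDiff E {i}))) :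
    i ∈ Q := by
  by_contra hiQ
  refine SCCs_stepGraph_ne (E := E) (E' := symmDiff E {i}) hi ?_ ?_
  · simp [Set.mem_symmDiff]
  · rw [← h₁, ← h₂]
    refine hQ _ fun j hj => ?_
    have hji : j ≠ i := fun h => hiQ (h ▸ hj)
    simp [Set.mem_symmDiff, hji]

theorem SymbolicAlgorithm.ComputesSCCs.le_two_mul_cost {n : ℕ} {A : SymbolicAlgorithm (Fin n)}
    (hA : A.ComputesSCCs) (E : Set ℕ) : n - 1 ≤ 2 * A.cost (stepGraph n E) := by
  obtain ⟨Q, hcard, hQ⟩ := A.exists_card_le_run_eq E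
  have hsub : Finset.range (n - 1) ⊆ Q := fun i hi =>
    mem_of_run_eq_SCCs hQ (by have := Finset.mem_range.1 hi; omega) (hA _) (hA _)
  simpa using (Finset.card_le_card hsub).trans hcard

/-- The probabilities of `S` and `T` sum to at most one plus that of any `U ⊇ S ∩ T`. -/
theorem PMF_toOuterMeasure_add_le {α : Type*} (p : PMF α) {S T U : Set α} (h : S ∩ T ⊆ U) :
    p.toOuterMeasure S + p.toOuterMeasure T ≤ 1 + p.toOuterMeasure U := by
  rw [p.toOuterMeasure_apply, p.toOuterMeasure_apply, p.toOuterMeasure_apply, ← p.tsum_coe,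
    ← ENNReal.tsum_add, ← ENNReal.tsum_add]
  refine ENNReal.tsum_le_tsum fun a => ?_
  by_cases hS : a ∈ S <;> by_cases hT : a ∈ T
  · simp [hS, hT, h ⟨hS, hT⟩]
  all_goals simp [hS, hT]

theorem RandomizedSymbolicAlgorithm.ComputesSCCsWithError.le_two_mul_expectedCost {n : ℕ}
    {A : RandomizedSymbolicAlgorithm (Fin n)} {ε : ℝ} (hε : ε < 1 / 2)
    (hA : A.ComputesSCCsWithError ε) (E : Set ℕ) :
    ENNReal.ofReal (1 - 2 * ε) * (n - 1 : ℕ) ≤ 2 * A.expectedCost (stepGraph n E) := by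
  choose Q hcard hQ using fun a : SymbolicAlgorithm (Fin n) => a.exists_card_le_run_eq E
  have hquery : ∀ i ∈ Finset.range (n - 1),
      ENNReal.ofReal (1 - 2 * ε) ≤ A.toOuterMeasure {a | i ∈ Q a} := by
    intro i hi
    -- A deterministic outcome correct on both `E` and `E` with edge `i` toggled inspects `i`; both
    -- events have probability at least `1 - ε`, so they overlap with probability at least `1 - 2ε`.
    have hle := (add_le_add (hA (stepGraph n E)) (hA (stepGraph n (symmDiff E {i})))).trans
      (PMF_toOuterMeasure_add_le A (U := {a | i ∈ Q a}) fun a ha =>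
        mem_of_run_eq_SCCs (hQ a) (by have := Finset.mem_range.1 hi; omega) ha.1 ha.2)
    rw [← ENNReal.ofReal_add (by linarith) (by linarith),
      show 1 - ε + (1 - ε) = 1 + (1 - 2 * ε) by ring,
      ENNReal.ofReal_add (by norm_num) (by linarith), ENNReal.ofReal_one] at hle
    exact (ENNReal.add_le_add_iff_left ENNReal.one_ne_top).1 hle
  calc ENNReal.ofReal (1 - 2 * ε) * (n - 1 : ℕ)
      = ∑ i ∈ Finset.range (n - 1), ENNReal.ofReal (1 - 2 * ε) := by simp [mul_comm]
    _ ≤ ∑ i ∈ Finset.range (n - 1), A.toOuterMeasure {a | i ∈ Q a} := Finset.sum_le_sum hquery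
    -- Exchanging the sums turns inspection probabilities into the expected number of inspected
    -- edges, at most twice the cost for each outcome.
    _ = ∑' a, ∑ i ∈ Finset.range (n - 1), ({a | i ∈ Q a} : Set _).indicator A a := by
      simp only [PMF.toOuterMeasure_apply]
      exact (Summable.tsum_finsetSum fun _ _ => ENNReal.summable).symm
    _ ≤ ∑' a, 2 * (A a * (a.cost (stepGraph n E) : ℝ≥0∞)) := by
      refine ENNReal.tsum_le_tsum fun a => ?_
      have hcount : ((Finset.range (n - 1)).filter (· ∈ Q a)).card ≤
          2 * a.cost (stepGraph n E) :=
        (Finset.card_le_card fun i hi => (Finset.mem_filter.1 hi).2).trans (hcard a)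
      simp only [Set.indicator_apply, Set.mem_ofPred_eq]
      rw [← Finset.sum_filter, Finset.sum_const, nsmul_eq_mul, mul_comm, mul_left_comm]
      gcongr
      exact_mod_cast hcount
    _ = 2 * A.expectedCost (stepGraph n E) := by rw [ENNReal.tsum_mul_left]; rfl

end SymbolicSCC

theorem theorem3p2 :
    (∃ c : ℝ, 0 < c ∧
      ∀ s d : ℕ, 1 ≤ s → 2 ≤ s + d →
        ∀ A : SymbolicSCC.SymbolicAlgorithm (Fin (s + d)), A.ComputesSCCs →
          ∃ G : Digraph (Fin (s + d)),
            (SymbolicSCC.SCCs G).ncard = s ∧ SymbolicSCC.sumSCCDiam G = d ∧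
              c * ((s : ℝ) + (d : ℝ)) ≤ (A.cost G : ℝ)) ∧
    (∀ ε : ℝ, 0 ≤ ε → ε < 1 / 2 → ∃ c : ℝ, 0 < c ∧
      ∀ s d : ℕ, 1 ≤ s → 2 ≤ s + d →
        ∀ A : SymbolicSCC.RandomizedSymbolicAlgorithm (Fin (s + d)),
          A.ComputesSCCsWithError ε →
          ∃ G : Digraph (Fin (s + d)),
            (SymbolicSCC.SCCs G).ncard = s ∧ SymbolicSCC.sumSCCDiam G = d ∧
              ENNReal.ofReal (c * ((s : ℝ) + (d : ℝ))) ≤ A.expectedCost G) := by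

  have hhalf : ∀ s d : ℕ, 2 ≤ s + d → ((s : ℝ) + d) / 2 ≤ ((s + d - 1 : ℕ) : ℝ) := by
    intro s d h
    have h' : (2 : ℝ) ≤ (s : ℝ) + d := by exact_mod_cast h
    rw [Nat.cast_sub (by omega)]
    push_cast
    linarith
  -- One factor `1 / 2` comes from `n - 1 ≥ n / 2` for `n ≥ 2`, the other from two inspected edges
  -- per operation; error `ε` contributes the factor `1 - 2 * ε`.
  refine ⟨⟨1 / 4, by norm_num, fun s d hs hsd A hA => ?_⟩,
    fun ε _ hε => ⟨(1 - 2 * ε) / 4, by linarith, fun s d hs hsd A hA => ?_⟩⟩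
  · refine ⟨SymbolicSCC.stepGraph (s + d) (Set.Iio d), SymbolicSCC.ncard_SCCs_stepGraph_Iio hs,
      SymbolicSCC.sumSCCDiam_stepGraph_Iio (by omega), ?_⟩
    have hcost : ((s + d - 1 : ℕ) : ℝ) ≤
        2 * (A.cost (SymbolicSCC.stepGraph (s + d) (Set.Iio d)) : ℝ) := by
      exact_mod_cast hA.le_two_mul_cost _
    linarith [hhalf s d hsd]
  · refine ⟨SymbolicSCC.stepGraph (s + d) (Set.Iio d), SymbolicSCC.ncard_SCCs_stepGraph_Iio hs,
      SymbolicSCC.sumSCCDiam_stepGraph_Iio (by omega), ?_⟩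
    refine (ENNReal.mul_le_mul_iff_right two_ne_zero ENNReal.ofNat_ne_top).1
      (le_trans ?_ (hA.le_two_mul_expectedCost hε _))
    rw [← ENNReal.ofReal_natCast, ← ENNReal.ofReal_mul (by linarith), ← ENNReal.ofReal_ofNat 2,
      ← ENNReal.ofReal_mul (by norm_num)]
    refine ENNReal.ofReal_le_ofReal ?_
    have := mul_le_mul_of_nonneg_left (hhalf s d hsd) (show 0 ≤ 1 - 2 * ε by linarith)
    linarith
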